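/- Let $\mathcal H=\mathcal H_A\otimes\mathcal H_B\otimes\mathcal H_C\otimes\mathcal H_D$ with $\mathcal H_A=\mathcal H_B=\mathcal H_C=\mathcal H_D=\mathbb C^2$. A four-qubit pure state is a unit vector $|\psi\rangle\in\mathcal H$, where unit vectors that differ only by a global phase are the same state. For a set $\mathcal S$ of parties, the marginal of $|\psi\rangle$ on $\mathcal S$ is $\rho_{\mathcal S}=\operatorname{Tr}_{\bar{\mathcal S}}(|\psi\rangle\langle\psi|)$, the partial trace over all parties outside $\mathcal S$. Theorem. For almost every unit vector $|\psi\rangle\in\mathcal H$ with respect to the Haar measure (the unitarily invariant probability measure on the unit sphere of $\mathcal H$), the state is uniquely determined among all pure states by its three two-body marginals $\rho_{AB}$, $\rho_{CD}$ and $\rho_{BD}$: if $|\phi\rangle\in\mathcal H$ is a unit vector with the same marginals on $AB$, $CD$ and $BD$ as $|\psi\rangle$, then $|\phi\rangle=e^{i\theta}|\psi\rangle$ for some $\theta\in\mathbb R$. In particular, almost every four-qubit pure state is 2-UDP (2-uniquely determined among pure states): no other pure state has the same six two-body marginals. -/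

import Mathlib

open MeasureTheory

noncomputable section

namespace QuantumMarginals

/-- Labels of the computational basis of a system of `d`-level particles, one for each element
of `P`. -/
abbrev Config (P : Type*) (d : ℕ) : Type _ := P → Fin d

/-- The Hilbert space of `n` particles of internal dimension `d`: the `n`-fold tensor power of
`ℂ ^ d`, written in coordinates with respect to the product basis. -/
abbrev StateSpace (n d : ℕ) : Type := EuclideanSpace ℂ (Config (Fin n) d)

/-- Normalised state vectors. -/
abbrev PureState (n d : ℕ) : Type := Metric.sphere (0 : StateSpace n d) 1

/-- The density operator `|ψ⟩⟨ψ|` as a matrix in the product basis. -/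
def density {n d : ℕ} (ψ : PureState n d) :
    Matrix (Config (Fin n) d) (Config (Fin n) d) ℂ :=
  Matrix.of fun x y => ψ.1 x * star (ψ.1 y)

/-- Glue basis labels of the parties in `S` and of the parties outside `S`. -/
def glue {n d : ℕ} (S : Finset (Fin n)) (a : Config {i // i ∈ S} d)
    (c : Config {i // i ∉ S} d) : Config (Fin n) d :=
  fun i => if h : i ∈ S then a ⟨i, h⟩ else c ⟨i, h⟩

/-- The partial trace over all parties outside `S`. -/
def reduce {n d : ℕ} (S : Finset (Fin n))
    (ρ : Matrix (Config (Fin n) d) (Config (Fin n) d) ℂ) :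
    Matrix (Config {i // i ∈ S} d) (Config {i // i ∈ S} d) ℂ :=
  Matrix.of fun a b => ∑ c : Config {i // i ∉ S} d, ρ (glue S a c) (glue S b c)

/-- The marginal `ρ_S` of the pure state `ψ` on the parties in `S`. -/
def marginal {n d : ℕ} (S : Finset (Fin n)) (ψ : PureState n d) :
    Matrix (Config {i // i ∈ S} d) (Config {i // i ∈ S} d) ℂ :=
  reduce S (density ψ)

/-- Two normalised vectors represent the same physical pure state: they agree up to a global
phase. -/
def SamePureState {n d : ℕ} (φ ψ : PureState n d) : Prop :=
  ∃ θ : ℝ, φ.1 = Complex.exp (θ * Complex.I) • ψ.1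

/-- `ψ` is uniquely determined among all pure states by its marginals on the sets of parties
that belong to `F`. -/
def DeterminedAmongPureBy {n d : ℕ} (F : Set (Finset (Fin n))) (ψ : PureState n d) : Prop :=
  ∀ φ : PureState n d, (∀ S ∈ F, marginal S φ = marginal S ψ) → SamePureState φ ψ

/-- `ψ` is `k`-uniquely determined among pure states (`k`-UDP): no other pure state has the same
`k`-body marginals. -/
def IsUDP {n d : ℕ} (k : ℕ) (ψ : PureState n d) : Prop :=
  DeterminedAmongPureBy {S | S.card = k} ψ

/-- The Haar measure on pure states: the surface measure of the unit sphere of the Hilbert space,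
normalised to total mass one. -/
def haarPure (n d : ℕ) : Measure (PureState n d) :=
  ((volume : Measure (StateSpace n d)).toSphere Set.univ)⁻¹ •
    (volume : Measure (StateSpace n d)).toSphere

end QuantumMarginals

end

/-! Write ψ as a matrix M with rows AB and columns CD. Its marginals on AB and CD are M Mᴴ and the
transpose of Mᴴ M. If N has the same two and M is invertible, then N M⁻¹ commutes with M Mᴴ
(`commute_of_mul_conjTranspose_eq`), so it is a polynomial in M Mᴴ as soon as M Mᴴ has a cyclic
vector. Thus N = ∑ t k • block M k with four unknown scalars, and M is the same sum with all t k =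
1. The marginals on AB and BD give equations linear in the products t k * conj (t l). Taking these
products and the quartic ones, each minus 1, as independent unknowns yields a homogeneous linear
system; if its kernel is trivial, all t k equal one common phase (`eq_smul_of_gram_eq`).

The three conditions on M (invertibility, cyclic vector, trivial kernel) are injectivity of linear
maps whose entries are polynomials in the coordinates and their conjugates. The interpolation nodes
are fixed numbers, not the eigenvalues of M Mᴴ, which keeps the dependence polynomial. Hence one
good vector suffices (`ae_injective`); an explicit one with integer Schmidt vectors is checked by
hand (`linearization_refMatrix_injective`). Scale invariance carries the result to the sphere. -/

noncomputable section
namespace QuantumMarginals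
open scoped ContDiff Matrix
open Polynomial

/-! ### Generic properties of real-analytic families, on the space and on the sphere -/

section Generic
open Set
variable {E : Type*} [NormedAddCommGroup E] [NormedSpace ℝ E] [FiniteDimensional ℝ E]
  [MeasurableSpace E] [BorelSpace E] (μ : Measure E) [μ.IsAddHaarMeasure]

/-- Integration in polar coordinates, for almost-everywhere statements. -/
lemma ae_iff_ae_sphere_prod {p : E → Prop} (h0 : p 0) :
    (∀ᵐ x ∂μ, p x) ↔ ∀ᵐ z ∂(μ.toSphere.prod (Measure.volumeIoiPow (Module.finrank ℝ E - 1))),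
      p ((z.2 : ℝ) • (z.1 : E)) := by
  have hm : MeasurableSet ({0}ᶜ : Set E) := (measurableSet_singleton 0).compl
  have h1 : (∀ᵐ x ∂μ, p x) ↔
      ∀ᵐ (x : ({0}ᶜ : Set E)) ∂(μ.comap Subtype.val), p x := by
    rw [← (MeasurableEmbedding.subtype_coe hm).ae_map_iff,
      (MeasurableEmbedding.subtype_coe hm).map_comap, Subtype.range_coe, ae_restrict_iff' hm]
    refine Filter.eventually_congr (.of_forall fun x => ⟨fun h _ => h, fun h => ?_⟩)
    by_cases hx : x = 0
    · rwa [hx]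
    · exact h hx
  rw [h1]
  have hp := μ.measurePreserving_homeomorphUnitSphereProd
  have he := (homeomorphUnitSphereProd E).measurableEmbedding
  rw [← hp.map_eq, he.ae_map_iff]
  refine Filter.eventually_congr (.of_forall fun x => ?_)
  have := congrArg Subtype.val ((homeomorphUnitSphereProd E).symm_apply_apply x)
  rw [homeomorphUnitSphereProd_symm_apply_coe] at this
  rw [this]

lemma ae_volumeIoiPow (n : ℕ) {p : ℝ → Prop} (hp : ∀ᵐ r, p r) :
    ∀ᵐ (r : Ioi (0 : ℝ)) ∂(Measure.volumeIoiPow n), p r := by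
  have he := MeasurableEmbedding.subtype_coe (measurableSet_Ioi (a := (0 : ℝ)))
  have h : ∀ᵐ (r : Ioi (0 : ℝ)) ∂(Measure.comap Subtype.val volume), p r := by
    rw [← he.ae_map_iff, he.map_comap]
    exact ae_restrict_of_ae hp
  exact (withDensity_absolutelyContinuous _ _).ae_le h

/-- Needed to extract an actual radius from a statement valid for almost every radius. -/
instance volumeIoiPow_neZero (n : ℕ) : NeZero (Measure.volumeIoiPow n) := by
  refine ⟨fun h => ?_⟩
  have := Measure.volumeIoiPow_apply_Iio n ⟨1, mem_Ioi.2 one_pos⟩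
  rw [h] at this
  simp only [Measure.coe_zero, Pi.zero_apply, one_pow, one_div] at this
  have h2 : (0 : ℝ) < (n + 1 : ℝ)⁻¹ := by positivity
  exact (ENNReal.ofReal_pos.2 h2).ne this

/-- A real-analytic function that does not vanish at some point vanishes almost nowhere. -/
lemma ae_ne_zero_of_contDiff_omega {F : Type*} [NormedAddCommGroup F] [NormedSpace ℝ F]
    {g : E → F} (hg : ContDiff ℝ ω g) {x₀ : E} (h0 : g x₀ ≠ 0) : ∀ᵐ x ∂μ, g x ≠ 0 := by
  -- Polar coordinates are centred at x₀, so every ray starts at a point where g is nonzero.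
  rw [← eventually_add_left_iff μ x₀,
    ae_iff_ae_sphere_prod μ (p := fun x => g (x₀ + x) ≠ 0) (by simpa using h0)]
  have hc : Continuous fun z : Metric.sphere (0 : E) 1 × Ioi (0 : ℝ) =>
      g (x₀ + (z.2 : ℝ) • (z.1 : E)) := hg.continuous.comp (by fun_prop)
  refine (Measure.ae_prod_iff_ae_ae (p := fun z : Metric.sphere (0 : E) 1 × Ioi (0 : ℝ) =>
      g (x₀ + (z.2 : ℝ) • (z.1 : E)) ≠ 0) (isOpen_ne.preimage hc).measurableSet).2 ?_
  refine .of_forall fun s => ae_volumeIoiPow _ (p := fun r => g (x₀ + r • (s : E)) ≠ 0) ?_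
  have ha : AnalyticOnNhd ℝ (fun r : ℝ => g (x₀ + r • (s : E))) univ := by
    rw [← contDiff_omega_iff_analyticOnNhd]
    exact hg.comp (by fun_prop)
  -- On each line through x₀ the zeros are isolated, hence a null set.
  have hd := ha.preimage_zero_mem_codiscrete (x := 0) (by simpa using h0)
  have h2 := ae_restrict_le_codiscreteWithin (μ := (volume : Measure ℝ))
    (U := (univ : Set ℝ)) MeasurableSet.univ hd
  rw [Measure.restrict_univ] at h2
  exact h2

/-- A property of vectors that is invariant under positive scaling and holds almost everywhere
holds almost everywhere on the unit sphere. -/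
lemma ae_toSphere_of_ae {p : E → Prop} (hs : ∀ x, ∀ r : ℝ, 0 < r → p (r • x) → p x)
    (h : ∀ᵐ x ∂μ, p x) : ∀ᵐ (s : Metric.sphere (0 : E) 1) ∂μ.toSphere, p s := by
  -- The weakened property holds at the origin, as the polar-coordinate lemma requires.
  have h' : ∀ᵐ x ∂μ, x ≠ 0 → p x := h.mono fun _ hx _ => hx
  rw [ae_iff_ae_sphere_prod μ (p := fun x => x ≠ 0 → p x) (fun h => absurd rfl h)] at h'
  refine (Measure.ae_ae_of_ae_prod h').mono fun s hs' => ?_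
  obtain ⟨r, hr⟩ := hs'.exists
  refine hs _ r r.2 (hr ?_)
  exact smul_ne_zero (mem_Ioi.1 r.2).ne' (ne_zero_of_mem_unit_sphere s)

/-- In a real-analytic family of linear maps, injectivity at one point implies injectivity almost
everywhere. -/
lemma ae_injective {V W : Type*} [NormedAddCommGroup V] [NormedSpace ℂ V] [FiniteDimensional ℂ V]
    [NormedAddCommGroup W] [NormedSpace ℂ W] [FiniteDimensional ℂ W]
    {f : E → V →ₗ[ℂ] W} (hf : ∀ v, ContDiff ℝ ω fun x => f x v) {x₀ : E}
    (h0 : Function.Injective (f x₀)) : ∀ᵐ x ∂μ, Function.Injective (f x) := by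
  -- With g a left inverse at x₀, det (g ∘ f x) is analytic and equals 1 at x₀; where it is nonzero,
  -- f x is injective.
  obtain ⟨g, hg⟩ := (f x₀).exists_leftInverse_of_injective (LinearMap.ker_eq_bot.2 h0)
  let b := Module.finBasis ℂ V
  have hdet : ContDiff ℝ ω fun x => LinearMap.det (g ∘ₗ f x) := by
    simp_rw [← LinearMap.det_toMatrix b, Matrix.det_apply]
    refine ContDiff.sum fun σ _ => ContDiff.const_smul _ (contDiff_prod fun i _ => ?_)
    let ℓ : W →L[ℝ] ℂ := (LinearMap.toContinuousLinearMap (b.coord (σ i) ∘ₗ g)).restrictScalars ℝ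
    have : ContDiff ℝ ω fun x => ℓ (f x (b i)) := ℓ.contDiff.comp (hf (b i))
    simpa [ℓ, LinearMap.toMatrix_apply] using this
  have hne : LinearMap.det (g ∘ₗ f x₀) ≠ 0 := by simp [hg]
  refine (ae_ne_zero_of_contDiff_omega μ hdet hne).mono fun x hx => ?_
  have := ((LinearMap.equivOfDetNeZero (g ∘ₗ f x) hx).injective)
  exact Function.Injective.of_comp (f := g) this

end Generic

/-! ### Linearising the quadratic system for the coefficients -/

section Linearization
variable {α ι : Type*} [Fintype ι]

/-- Linear relations satisfied by the differences `(t k * conj (t l) - 1)` and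
`(t k * t m * conj (t l) * conj (t n) - 1)` when `t` solves the quadratic system
`∑ t k * conj (t l) * T a k l = ∑ T a k l`. -/
def linearization (T : α → ι → ι → ℂ) :
    ((ι → ι → ℂ) × (ι → ι → ι → ι → ℂ)) →ₗ[ℂ]
      ((α → ℂ) × (α → ι → ι → ℂ) × (ι → ι → ι → ι → ℂ) × (ι → ι → ι → ι → ℂ)) where
  toFun x := (fun a => ∑ k, ∑ l, x.1 k l * T a k l,
    fun a m n => ∑ k, ∑ l, (x.2 k m l n - x.1 m n) * T a k l,
    fun k m l n => x.2 k m l n - x.2 m k l n,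
    fun k m l n => x.2 k m l n - x.2 k m n l)
  map_add' x y := by
    refine Prod.ext ?_ (Prod.ext ?_ (Prod.ext ?_ ?_)) <;> funext <;>
      simp only [Prod.fst_add, Prod.snd_add, Pi.add_apply, ← Finset.sum_add_distrib]
    · simp only [add_mul]
    · exact Finset.sum_congr rfl fun _ _ => Finset.sum_congr rfl fun _ _ => by ring
    · ring
    · ring
  map_smul' c x := by
    refine Prod.ext ?_ (Prod.ext ?_ (Prod.ext ?_ ?_)) <;> funext <;>
      simp only [Prod.smul_fst, Prod.smul_snd, Pi.smul_apply, smul_eq_mul, RingHom.id_apply,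
        Finset.mul_sum, mul_assoc, ← mul_sub]

lemma mul_star_eq_one_of_linearization_injective {T : α → ι → ι → ℂ}
    (hT : Function.Injective (linearization T)) {t : ι → ℂ}
    (ht : ∀ a, ∑ k, ∑ l, t k * star (t l) * T a k l = ∑ k, ∑ l, T a k l) (k l : ι) :
    t k * star (t l) = 1 := by
  have h := @hT (fun k l => t k * star (t l) - 1,
    fun k m l n => t k * t m * star (t l) * star (t n) - 1) 0 ?_
  · exact sub_eq_zero.1 (congrFun (congrFun (congrArg Prod.fst h) k) l)
  · rw [map_zero]
    refine Prod.ext ?_ (Prod.ext ?_ (Prod.ext ?_ ?_)) <;> funext <;>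
      simp only [linearization, LinearMap.coe_mk, AddHom.coe_mk, Prod.fst_zero, Prod.snd_zero,
        Pi.zero_apply]
    · rename_i a
      simp only [sub_mul, one_mul, Finset.sum_sub_distrib, ht, sub_self]
    · rename_i a m n
      -- The second family of relations is the original system multiplied by t m * conj (t n).
      have : ∀ k l, (t k * t m * star (t l) * star (t n) - 1 - (t m * star (t n) - 1)) * T a k l
          = t m * star (t n) * (t k * star (t l) * T a k l - T a k l) := fun k l => by ring
      simp only [this, ← Finset.mul_sum, Finset.sum_sub_distrib, ht, sub_self, mul_zero]
    · ring
    · ring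

end Linearization

/-! ### Matrices commuting with a cyclic matrix -/

section Commutant
variable {n ι : Type*} [Fintype n] [DecidableEq n] [Fintype ι] [DecidableEq ι]

/-- The Lagrange interpolation polynomials at the nodes `c`, evaluated at a matrix. If the nodes
are the eigenvalues, these are the spectral projections. -/
def lagrangeMatrix (c : ι → ℂ) (R : Matrix n n ℂ) (i : ι) : Matrix n n ℂ :=
  aeval R (Lagrange.basis Finset.univ c i)

lemma sum_lagrangeMatrix [Nonempty ι] {c : ι → ℂ} (hc : Function.Injective c)
    (R : Matrix n n ℂ) : ∑ i, lagrangeMatrix c R i = 1 := by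
  unfold lagrangeMatrix
  rw [← map_sum, Lagrange.sum_basis hc.injOn Finset.univ_nonempty, map_one]

lemma aeval_mulVec_of_eigenvector {R : Matrix n n ℂ} {μ : ℂ} {v : n → ℂ} (h : R *ᵥ v = μ • v)
    (p : ℂ[X]) : aeval R p *ᵥ v = p.eval μ • v := by
  induction p using Polynomial.induction_on with
  | C a => simp [Algebra.algebraMap_eq_smul_one, Matrix.smul_mulVec]
  | add p q hp hq => simp [Matrix.add_mulVec, hp, hq, add_smul]
  | monomial k a ih =>
    rw [pow_succ, ← mul_assoc, map_mul, aeval_X, ← Matrix.mulVec_mulVec, h, Matrix.mulVec_smul, ih,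
      smul_smul, eval_mul_X, mul_comm]

lemma lagrangeMatrix_mulVec {c : ι → ℂ} (hc : Function.Injective c) {R : Matrix n n ℂ}
    {v : ι → n → ℂ} (h : ∀ j, R *ᵥ v j = c j • v j) (i j : ι) :
    lagrangeMatrix c R i *ᵥ v j = if i = j then v j else 0 := by
  rw [lagrangeMatrix, aeval_mulVec_of_eigenvector (h j)]
  split_ifs with hij
  · rw [hij, Lagrange.eval_basis_self hc.injOn (Finset.mem_univ _), one_smul]
  · rw [Lagrange.eval_basis_of_ne hij (Finset.mem_univ _), zero_smul]

/-- If `e` is a cyclic vector for `R`, every matrix that commutes with `R` is a polynomial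
in `R`. -/
lemma exists_eq_sum_of_commute {c : ι → ℂ} {R U : Matrix n n ℂ} (hU : Commute U R) {e : n → ℂ}
    (he : Function.Surjective (Fintype.linearCombination ℂ fun i => lagrangeMatrix c R i *ᵥ e)) :
    ∃ t : ι → ℂ, U = ∑ i, t i • lagrangeMatrix c R i := by
  -- The two sides agree at e and both commute with R, so they agree on all polynomials in R applied
  -- to e, which span.
  obtain ⟨t, ht⟩ := he (U *ᵥ e)
  refine ⟨t, Matrix.toLin'.injective (LinearMap.ext fun x => ?_)⟩
  obtain ⟨s, rfl⟩ := he x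
  have hRU : ∀ p : ℂ[X], Commute U (aeval R p) := fun p => by
    induction p using Polynomial.induction_on with
    | C a => rw [aeval_C]; exact (Algebra.commutes a U).symm
    | add p q hp hq => rw [map_add]; exact hp.add_right hq
    | monomial k a ih => rw [pow_succ, ← mul_assoc, map_mul, aeval_X]; exact ih.mul_right hU
  have hp : ∀ p q : ℂ[X], Commute (aeval R p) (aeval R q) := fun p q => by
    rw [Commute, SemiconjBy, ← map_mul, mul_comm, map_mul]
  simp only [Fintype.linearCombination_apply] at ht ⊢
  simp only [map_sum, map_smul, Matrix.toLin'_apply]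
  refine Finset.sum_congr rfl fun j _ => ?_
  congr 1
  rw [Matrix.mulVec_mulVec, lagrangeMatrix, (hRU _).eq, ← Matrix.mulVec_mulVec, ← ht]
  simp only [Matrix.mulVec_sum, LinearMap.sum_apply, LinearMap.smul_apply, Matrix.toLin'_apply,
    Matrix.mulVec_smul, Matrix.mulVec_mulVec, lagrangeMatrix, (hp _ _).eq]

/-- The key identity is M Mᴴ N = N Nᴴ N = N Mᴴ M. -/
lemma commute_of_mul_conjTranspose_eq {M N : Matrix n n ℂ} (hM : IsUnit M.det)
    (h1 : N * Nᴴ = M * Mᴴ) (h2 : Nᴴ * N = Mᴴ * M) : Commute (N * M⁻¹) (M * Mᴴ) := by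
  have hR : M * Mᴴ * N = N * Mᴴ * M := by rw [← h1, mul_assoc, h2, mul_assoc]
  have e1 : N * M⁻¹ * (M * Mᴴ) = N * Mᴴ := by
    rw [mul_assoc, ← mul_assoc M⁻¹, Matrix.nonsing_inv_mul _ hM, one_mul]
  have e2 : M * Mᴴ * (N * M⁻¹) = N * Mᴴ := by
    rw [← mul_assoc, hR, mul_assoc, Matrix.mul_nonsing_inv _ hM, mul_one]
  exact e1.trans e2.symm

end Commutant

/-! ### Coefficient matrices and the criterion for determination -/

/-- A four-qubit vector as a matrix, with rows labelled by `AB` and columns labelled by `CD`. -/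
def coeffMatrix (ψ : StateSpace 4 2) : Matrix (Fin 2 × Fin 2) (Fin 2 × Fin 2) ℂ :=
  Matrix.of fun p q => ψ ![p.1, p.2, q.1, q.2]

/-- The polarised marginals on `AB` and on `BD`. -/
def gram (X Y : Matrix (Fin 2 × Fin 2) (Fin 2 × Fin 2) ℂ) :
    ((Fin 2 × Fin 2) × (Fin 2 × Fin 2)) ⊕ ((Fin 2 × Fin 2) × (Fin 2 × Fin 2)) → ℂ :=
  Sum.elim (fun p => ∑ z : Fin 2 × Fin 2, X p.1 z * star (Y p.2 z))
    (fun p => ∑ z : Fin 2 × Fin 2,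
      X (z.1, p.1.1) (z.2, p.1.2) * star (Y (z.1, p.2.1) (z.2, p.2.2)))

lemma gram_sum {ι : Type*} [Fintype ι] (t : ι → ℂ)
    (B : ι → Matrix (Fin 2 × Fin 2) (Fin 2 × Fin 2) ℂ) (a) :
    gram (∑ k, t k • B k) (∑ k, t k • B k) a =
      ∑ k, ∑ l, t k * star (t l) * gram (B k) (B l) a := by
  rcases a with p | p <;>
  · simp only [gram, Sum.elim_inl, Sum.elim_inr, Matrix.sum_apply, Matrix.smul_apply, smul_eq_mul,
      star_sum, star_mul', Finset.sum_mul_sum]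
    rw [Finset.sum_comm]
    refine Finset.sum_congr rfl fun k _ => ?_
    rw [Finset.sum_comm]
    refine Finset.sum_congr rfl fun l _ => ?_
    rw [Finset.mul_sum]
    exact Finset.sum_congr rfl fun z _ => by ring

/-- The eigenvalues of the reduced density operator of the reference state. -/
def nodes : Fin 4 → ℂ := ![6, 12, 2, 9]

lemma nodes_injective : Function.Injective nodes := by
  intro i j
  fin_cases i <;> fin_cases j <;> norm_num [nodes]

/-- A cyclic vector for the reduced density operator on `AB` of a generic state. -/
def cyclicVector : Fin 2 × Fin 2 → ℂ := fun p => if p.2 = 0 then 1 else 0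

/-- The Schmidt components of a matrix whose squared singular values are the nodes. -/
def block (M : Matrix (Fin 2 × Fin 2) (Fin 2 × Fin 2) ℂ) (k : Fin 4) :
    Matrix (Fin 2 × Fin 2) (Fin 2 × Fin 2) ℂ := lagrangeMatrix nodes (M * Mᴴ) k * M

lemma sum_block (M : Matrix (Fin 2 × Fin 2) (Fin 2 × Fin 2) ℂ) : ∑ k, block M k = M := by
  simp only [block, ← Finset.sum_mul, sum_lagrangeMatrix nodes_injective, one_mul]

/-- The linear map sending coefficients to the corresponding combination of Lagrange polynomials
in the reduced density operator, applied to the cyclic vector. -/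
def cyclicMap (M : Matrix (Fin 2 × Fin 2) (Fin 2 × Fin 2) ℂ) :
    (Fin 4 → ℂ) →ₗ[ℂ] (Fin 2 × Fin 2 → ℂ) :=
  Fintype.linearCombination ℂ fun i => lagrangeMatrix nodes (M * Mᴴ) i *ᵥ cyclicVector

/-- The polarised marginals of the Schmidt components. -/
def gramBlock (M : Matrix (Fin 2 × Fin 2) (Fin 2 × Fin 2) ℂ)
    (a : ((Fin 2 × Fin 2) × (Fin 2 × Fin 2)) ⊕ ((Fin 2 × Fin 2) × (Fin 2 × Fin 2)))
    (k l : Fin 4) : ℂ := gram (block M k) (block M l) a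

theorem eq_smul_of_gram_eq {M N : Matrix (Fin 2 × Fin 2) (Fin 2 × Fin 2) ℂ}
    (hM : Function.Injective M.mulVecLin) (hC : Function.Injective (cyclicMap M))
    (hL : Function.Injective (linearization (gramBlock M)))
    (h1 : gram N N = gram M M) (h2 : Nᴴ * N = Mᴴ * M) :
    ∃ z : ℂ, ‖z‖ = 1 ∧ N = z • M := by
  have hdet : IsUnit M.det :=
    (Matrix.isUnit_iff_isUnit_det _).1 (Matrix.mulVec_injective_iff_isUnit.1 hM)
  have hAB : N * Nᴴ = M * Mᴴ := by
    ext p q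
    simpa [gram, Matrix.mul_apply] using congrFun h1 (Sum.inl (p, q))
  obtain ⟨t, ht⟩ := exists_eq_sum_of_commute (commute_of_mul_conjTranspose_eq hdet hAB h2)
    ((LinearMap.injective_iff_surjective_of_finrank_eq_finrank (by simp)).1 hC)
  have hN : N = ∑ k, t k • block M k := by
    rw [← Matrix.nonsing_inv_mul_cancel_right _ N hdet, ht]
    simp only [Finset.sum_mul, Matrix.smul_mul, block]
  -- Expanding the marginals of N with coefficients t, and those of M with all coefficients 1, gives
  -- the quadratic system.
  have hone := mul_star_eq_one_of_linearization_injective hL (t := t) fun a => by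
    have e1 := gram_sum t (block M) a
    have e2 := gram_sum 1 (block M) a
    simp only [Pi.one_apply, one_smul, sum_block, star_one, one_mul] at e2
    rw [← hN, h1, e2] at e1
    exact e1.symm
  have h0 : star (t 0) ≠ 0 := fun h => by simpa [h] using hone 0 0
  have heq : ∀ k, t k = t 0 := fun k => mul_right_cancel₀ h0 ((hone k 0).trans (hone 0 0).symm)
  refine ⟨t 0, ?_, ?_⟩
  · have := congrArg norm (hone 0 0)
    rw [norm_mul, norm_star, norm_one] at this
    nlinarith [norm_nonneg (t 0)]
  · rw [hN]
    simp only [heq, ← Finset.smul_sum, sum_block]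

/-! ### Analytic dependence on the state -/

section Analytic
variable {E : Type*} [NormedAddCommGroup E] [NormedSpace ℝ E] {n : Type*} [Fintype n]
  {A B : E → Matrix n n ℂ}

lemma contDiff_conj {f : E → ℂ} (hf : ContDiff ℝ ω f) : ContDiff ℝ ω fun x => star (f x) :=
  Complex.conjCLE.contDiff.comp hf

lemma contDiff_matrix_mul (hA : ∀ i j, ContDiff ℝ ω fun x => A x i j)
    (hB : ∀ i j, ContDiff ℝ ω fun x => B x i j) (i j : n) :
    ContDiff ℝ ω fun x => (A x * B x) i j := by
  simp only [Matrix.mul_apply]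
  exact ContDiff.sum fun k _ => (hA i k).mul (hB k j)

lemma contDiff_mulVec (hA : ∀ i j, ContDiff ℝ ω fun x => A x i j) (v : n → ℂ) (i : n) :
    ContDiff ℝ ω fun x => (A x *ᵥ v) i := by
  simp only [Matrix.mulVec, dotProduct]
  exact ContDiff.sum fun k _ => (hA i k).mul contDiff_const

lemma contDiff_aeval [DecidableEq n] (hA : ∀ i j, ContDiff ℝ ω fun x => A x i j) (p : ℂ[X]) :
    ∀ i j, ContDiff ℝ ω fun x => aeval (A x) p i j := by
  induction p using Polynomial.induction_on with
  | C a => intro i j; simp only [aeval_C]; exact contDiff_const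
  | add p q hp hq =>
    intro i j; simp only [map_add, Matrix.add_apply]; exact (hp i j).add (hq i j)
  | monomial k a ih =>
    intro i j
    simp only [pow_succ, ← mul_assoc, map_mul, aeval_X]
    simp only [map_mul] at ih
    exact contDiff_matrix_mul ih hA i j

end Analytic

lemma contDiff_coeffMatrix (p q : Fin 2 × Fin 2) : ContDiff ℝ ω fun ψ => coeffMatrix ψ p q := by
  simp only [coeffMatrix, Matrix.of_apply]
  fun_prop

lemma contDiff_lagrangeMatrix (k : Fin 4) (p q : Fin 2 × Fin 2) : ContDiff ℝ ω fun ψ =>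
    lagrangeMatrix nodes (coeffMatrix ψ * (coeffMatrix ψ)ᴴ) k p q :=
  contDiff_aeval (contDiff_matrix_mul contDiff_coeffMatrix
    fun i j => contDiff_conj (contDiff_coeffMatrix j i)) _ p q

lemma contDiff_block (k : Fin 4) (p q : Fin 2 × Fin 2) :
    ContDiff ℝ ω fun ψ => block (coeffMatrix ψ) k p q :=
  contDiff_matrix_mul (contDiff_lagrangeMatrix k) contDiff_coeffMatrix p q

lemma contDiff_gramBlock (a) (k l : Fin 4) :
    ContDiff ℝ ω fun ψ => gramBlock (coeffMatrix ψ) a k l := by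
  rcases a with p | p <;> simp only [gramBlock, gram, Sum.elim_inl, Sum.elim_inr] <;>
  exact ContDiff.sum fun z _ => (contDiff_block _ _ _).mul (contDiff_conj (contDiff_block _ _ _))

/-- If one vector is nondegenerate, then almost every vector is. -/
theorem ae_nondegenerate {ψ₀ : StateSpace 4 2}
    (hM : Function.Injective (coeffMatrix ψ₀).mulVecLin)
    (hC : Function.Injective (cyclicMap (coeffMatrix ψ₀)))
    (hL : Function.Injective (linearization (gramBlock (coeffMatrix ψ₀)))) :
    ∀ᵐ ψ : StateSpace 4 2, Function.Injective (coeffMatrix ψ).mulVecLin ∧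
      Function.Injective (cyclicMap (coeffMatrix ψ)) ∧
      Function.Injective (linearization (gramBlock (coeffMatrix ψ))) := by
  refine (ae_injective volume (f := fun ψ => (coeffMatrix ψ).mulVecLin) (fun v => ?_) hM).and
    ((ae_injective volume (f := fun ψ => cyclicMap (coeffMatrix ψ)) (fun v => ?_) hC).and
    (ae_injective volume (f := fun ψ => linearization (gramBlock (coeffMatrix ψ)))
      (fun v => ?_) hL))
  · exact contDiff_pi.2 fun i => contDiff_mulVec contDiff_coeffMatrix v i
  · simp only [cyclicMap, Fintype.linearCombination_apply]
    exact ContDiff.sum fun k _ => contDiff_pi.2 fun i =>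
      (contDiff_const (c := v k)).mul (contDiff_mulVec (contDiff_lagrangeMatrix k) cyclicVector i)
  · refine ContDiff.prodMk ?_ (ContDiff.prodMk ?_ (ContDiff.prodMk contDiff_const contDiff_const))
    · exact contDiff_pi.2 fun a => ContDiff.sum fun k _ => ContDiff.sum fun l _ =>
        contDiff_const.mul (contDiff_gramBlock a k l)
    · exact contDiff_pi.2 fun a => contDiff_pi.2 fun m => contDiff_pi.2 fun n =>
        ContDiff.sum fun k _ => ContDiff.sum fun l _ =>
          contDiff_const.mul (contDiff_gramBlock a k l)


/-! ### The reference state and its Schmidt decomposition -/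

/-- Left Schmidt vectors of the reference state. -/
def leftVec : Fin 4 → Fin 2 × Fin 2 → ℂ := fun i p =>
  (![![![0, 0], ![1, 0]], ![![1, -2], ![0, 1]], ![![1, 0], ![0, -1]], ![![1, 1], ![0, 1]]] :
    Fin 4 → Fin 2 → Fin 2 → ℂ) i p.1 p.2

/-- Right Schmidt vectors of the reference state. -/
def rightVec : Fin 4 → Fin 2 × Fin 2 → ℂ := fun i p =>
  (![![![2, 1], ![0, 1]], ![![0, 1], ![0, -1]], ![![0, 0], ![1, 0]], ![![1, -1], ![0, -1]]] :
    Fin 4 → Fin 2 → Fin 2 → ℂ) i p.1 p.2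

/-- The coefficient matrix of the reference state, in Schmidt form. -/
def refMatrix : Matrix (Fin 2 × Fin 2) (Fin 2 × Fin 2) ℂ :=
  ∑ i, Matrix.vecMulVec (leftVec i) (rightVec i)

/-- The (unnormalised) reference state. -/
def refState : StateSpace 4 2 := WithLp.toLp 2 fun x => refMatrix (x 0, x 1) (x 2, x 3)

lemma coeffMatrix_refState : coeffMatrix refState = refMatrix := by
  ext p q
  simp [coeffMatrix, refState]

/-- Multiplying these squared norms by those of the right vectors, 6, 2, 1, 3, gives the four
distinct nodes. -/
lemma leftVec_dot (i j : Fin 4) :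
    ∑ p, star (leftVec i p) * leftVec j p = if i = j then (![1, 6, 2, 3] : Fin 4 → ℂ) j else 0 := by
  fin_cases i <;> fin_cases j <;>
    simp [leftVec, map_ofNat, Fintype.sum_prod_type, Fin.sum_univ_two] <;> norm_num

lemma rightVec_dot (i j : Fin 4) :
    ∑ p, rightVec i p * star (rightVec j p) =
      if i = j then (![6, 2, 1, 3] : Fin 4 → ℂ) j else 0 := by
  fin_cases i <;> fin_cases j <;>
    simp [rightVec, map_ofNat, Fintype.sum_prod_type, Fin.sum_univ_two] <;> norm_num

lemma refMatrix_mulVec_rightVec (j : Fin 4) :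
    refMatrix *ᵥ star (rightVec j) = (![6, 2, 1, 3] : Fin 4 → ℂ) j • leftVec j := by
  have h := fun i => rightVec_dot i j
  ext p
  simp only [refMatrix, Matrix.sum_mulVec, Matrix.vecMulVec_mulVec, Finset.sum_apply, Pi.smul_apply,
    dotProduct, Pi.star_apply, h, MulOpposite.smul_eq_mul_unop, MulOpposite.unop_op]
  simp [mul_comm]

lemma refMatrix_conjTranspose_mulVec_leftVec (j : Fin 4) :
    refMatrixᴴ *ᵥ leftVec j = (![1, 6, 2, 3] : Fin 4 → ℂ) j • star (rightVec j) := by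
  have h := fun i => leftVec_dot i j
  ext p
  simp only [refMatrix, Matrix.conjTranspose_sum, Matrix.conjTranspose_vecMulVec, Matrix.sum_mulVec,
    Matrix.vecMulVec_mulVec, Finset.sum_apply, Pi.smul_apply,
    dotProduct, Pi.star_apply, h, MulOpposite.smul_eq_mul_unop, MulOpposite.unop_op]
  simp [mul_comm]

lemma refMatrix_mul_conjTranspose_mulVec (j : Fin 4) :
    (refMatrix * refMatrixᴴ) *ᵥ leftVec j = nodes j • leftVec j := by
  rw [← Matrix.mulVec_mulVec, refMatrix_conjTranspose_mulVec_leftVec, Matrix.mulVec_smul,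
    refMatrix_mulVec_rightVec, smul_smul]
  congr 1
  fin_cases j <;> norm_num [nodes]

lemma lagrangeMatrix_refMatrix (i j : Fin 4) :
    lagrangeMatrix nodes (refMatrix * refMatrixᴴ) i *ᵥ leftVec j =
      if i = j then leftVec j else 0 :=
  lagrangeMatrix_mulVec nodes_injective refMatrix_mul_conjTranspose_mulVec i j

/-- Here the nodes are the true eigenvalues, so the interpolation polynomials act as spectral
projections and isolate single Schmidt terms. -/
lemma block_refMatrix (i : Fin 4) :
    block refMatrix i = Matrix.vecMulVec (leftVec i) (rightVec i) := by
  have h : ∀ R : Matrix (Fin 2 × Fin 2) (Fin 2 × Fin 2) ℂ,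
      R * refMatrix = ∑ j, Matrix.vecMulVec (R *ᵥ leftVec j) (rightVec j) := fun R => by
    simp only [refMatrix, Finset.mul_sum, Matrix.mul_vecMulVec]
  rw [block, h, Finset.sum_eq_single i]
  · rw [lagrangeMatrix_refMatrix, if_pos rfl]
  · intro j _ hj
    rw [lagrangeMatrix_refMatrix, if_neg hj.symm, Matrix.zero_vecMulVec]
  · simp

lemma eq_zero_of_sum_smul_leftVec {t : Fin 4 → ℂ} (h : ∑ i, t i • leftVec i = 0) : t = 0 := by
  have h' := fun p => congrFun h p
  simp only [Finset.sum_apply, Pi.smul_apply, smul_eq_mul, Fin.sum_univ_four, Pi.zero_apply] at h'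
  have a := h' (0, 0)
  have b := h' (0, 1)
  have c := h' (1, 0)
  have d := h' (1, 1)
  simp [leftVec] at a b c d
  funext i
  fin_cases i <;> simp <;> grind

lemma eq_zero_of_rightVec_dotProduct {v : Fin 2 × Fin 2 → ℂ} (h : ∀ i, rightVec i ⬝ᵥ v = 0) :
    v = 0 := by
  have a := h 0
  have b := h 1
  have c := h 2
  have d := h 3
  simp [rightVec, dotProduct, Fintype.sum_prod_type, Fin.sum_univ_two] at a b c d
  funext ⟨i, j⟩
  fin_cases i <;> fin_cases j <;> simp <;> grind

lemma refMatrix_mulVecLin_injective : Function.Injective refMatrix.mulVecLin := by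
  rw [← LinearMap.ker_eq_bot, LinearMap.ker_eq_bot']
  intro v hv
  refine eq_zero_of_rightVec_dotProduct fun i => congrFun (eq_zero_of_sum_smul_leftVec
    (t := fun i => rightVec i ⬝ᵥ v) ?_) i
  rw [← hv, Matrix.mulVecLin_apply, refMatrix, Matrix.sum_mulVec]
  refine Finset.sum_congr rfl fun j _ => ?_
  rw [Matrix.vecMulVec_mulVec]
  ext p
  simp [mul_comm]

/-- The coefficients are overlaps with the orthogonal left vectors divided by squared norms. None of
them vanishes, which makes the vector cyclic. -/
lemma cyclicVector_eq_sum :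
    cyclicVector = ∑ j, (![1, 1 / 6, 1 / 2, 1 / 3] : Fin 4 → ℂ) j • leftVec j := by
  ext ⟨i, j⟩
  fin_cases i <;> fin_cases j <;>
    simp [cyclicVector, leftVec, Fin.sum_univ_four] <;> norm_num

lemma cyclicMap_refMatrix_injective : Function.Injective (cyclicMap refMatrix) := by
  rw [← LinearMap.ker_eq_bot, LinearMap.ker_eq_bot']
  intro t ht
  have h : ∑ i, (t i * (![1, 1 / 6, 1 / 2, 1 / 3] : Fin 4 → ℂ) i) • leftVec i = 0 := by
    rw [← ht, cyclicMap, Fintype.linearCombination_apply]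
    refine Finset.sum_congr rfl fun i _ => ?_
    rw [cyclicVector_eq_sum, Matrix.mulVec_sum, Finset.sum_eq_single i, Matrix.mulVec_smul,
      lagrangeMatrix_refMatrix, if_pos rfl, smul_smul]
    · intro j _ hj
      rw [Matrix.mulVec_smul, lagrangeMatrix_refMatrix, if_neg hj.symm, smul_zero]
    · simp
  have h' := fun i => congrFun (eq_zero_of_sum_smul_leftVec h) i
  funext i
  have := h' i
  fin_cases i <;> simpa using this


/-! ### Trivial kernel of the linearised system at the reference state -/

lemma gramBlock_refMatrix_inl (p q : Fin 2 × Fin 2) (k l : Fin 4) :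
    gramBlock refMatrix (Sum.inl (p, q)) k l =
      leftVec k p * star (leftVec l q) * if k = l then (![6, 2, 1, 3] : Fin 4 → ℂ) l else 0 := by
  rw [← rightVec_dot, Finset.mul_sum]
  simp only [gramBlock, gram, block_refMatrix, Sum.elim_inl, Matrix.vecMulVec_apply, star_mul']
  exact Finset.sum_congr rfl fun z _ => by ring

lemma gramBlock_refMatrix_inr (b d b' d' : Fin 2) (k l : Fin 4) :
    gramBlock refMatrix (Sum.inr ((b, d), (b', d'))) k l =
      (∑ a, leftVec k (a, b) * star (leftVec l (a, b'))) *
        ∑ c, rightVec k (c, d) * star (rightVec l (c, d')) := by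
  simp only [gramBlock, gram, block_refMatrix, Sum.elim_inr, Matrix.vecMulVec_apply, star_mul',
    Fintype.sum_prod_type, Finset.sum_mul_sum]
  exact Finset.sum_congr rfl fun a _ => Finset.sum_congr rfl fun c _ => by ring

/-- The relations that express the invariance of the marginal on `AB`. -/
lemma eq_zero_of_sum_gramBlock_inl {x : Fin 4 → Fin 4 → ℂ}
    (h : ∀ p q, ∑ k, ∑ l, x k l * gramBlock refMatrix (Sum.inl (p, q)) k l = 0) (k : Fin 4) :
    x k k = 0 := by
  have h' : ∀ p q, ∑ k, x k k * (leftVec k p * star (leftVec k q) *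
      (![6, 2, 1, 3] : Fin 4 → ℂ) k) = 0 := fun p q => by
    rw [← h p q]
    refine Finset.sum_congr rfl fun k _ => ?_
    rw [Finset.sum_eq_single k]
    · rw [gramBlock_refMatrix_inl, if_pos rfl]
    · intro l _ hl
      rw [gramBlock_refMatrix_inl, if_neg hl.symm, mul_zero, mul_zero]
    · simp
  -- These four entries already form an invertible system for the four diagonal unknowns.
  have a := h' (0, 0) (0, 0)
  have b := h' (0, 0) (0, 1)
  have c := h' (0, 1) (0, 1)
  have d := h' (1, 0) (1, 0)
  simp [leftVec, map_ofNat, Fin.sum_univ_four] at a b c d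
  fin_cases k <;> simp <;> grind

/-- The relations that express the invariance of the marginal on `BD`. -/
lemma relations_of_sum_gramBlock_inr {x : Fin 4 → Fin 4 → ℂ} (hd : ∀ k, x k k = 0)
    (h : ∀ a, ∑ k, ∑ l, x k l * gramBlock refMatrix (Sum.inr a) k l = 0) :
    x 0 3 = 0 ∧ x 3 0 = 0 ∧ x 3 1 = x 2 1 + x 2 3 ∧ x 1 3 = x 1 2 + x 3 2 ∧ x 0 2 = x 1 3 ∧
      x 2 0 = x 3 1 ∧ 2 * x 0 1 + 2 * x 2 1 = x 2 3 + 2 * x 3 1 ∧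
      2 * x 1 0 + 2 * x 1 2 = x 3 2 + 2 * x 1 3 := by
  -- Four off-diagonal entries and their transposes. The reference vectors are real, so transposing
  -- swaps the indices of x.
  have a4 := h ((0, 0), (1, 0))
  have a8 := h ((1, 0), (0, 0))
  have a1 := h ((0, 0), (0, 1))
  have a2 := h ((0, 1), (0, 0))
  have a5 := h ((0, 0), (1, 1))
  have a6 := h ((0, 1), (1, 0))
  have a9 := h ((1, 0), (0, 1))
  have a10 := h ((1, 1), (0, 0))
  simp [gramBlock_refMatrix_inr, leftVec, rightVec, map_ofNat, Fin.sum_univ_four, hd]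
    at a1 a2 a4 a5 a6 a8 a9 a10
  grind

/-- The relations between the quadratic unknowns force the linear unknowns to vanish. -/
lemma linear_part_eq_zero {G : Fin 4 → Fin 4 → ℂ} {W : Fin 4 → Fin 4 → Fin 4 → Fin 4 → ℂ}
    (hs : ∀ k m l n, W k m l n = W m k l n) (ht : ∀ k m l n, W k m l n = W k m n l)
    (hG : ∀ k, G k k = 0) (hd : ∀ k m n, W k m k n = G m n)
    (h03 : ∀ m n, W 0 m 3 n = G m n) (h30 : ∀ m n, W 3 m 0 n = G m n)
    (h31 : ∀ m n, W 3 m 1 n = W 2 m 1 n + W 2 m 3 n - G m n)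
    (h13 : ∀ m n, W 1 m 3 n = W 1 m 2 n + W 3 m 2 n - G m n)
    (h02 : ∀ m n, W 0 m 2 n = W 1 m 3 n) (h20 : ∀ m n, W 2 m 0 n = W 3 m 1 n)
    (h02' : G 0 2 = G 1 3) (h21 : 2 * G 0 1 + 2 * G 2 1 = G 2 3 + 2 * G 3 1)
    (h12 : 2 * G 1 0 + 2 * G 1 2 = G 3 2 + 2 * G 1 3) : G = 0 := by
  have hd' : ∀ k m n, W m k k n = G m n := fun k m n => (hs _ _ _ _).trans (hd k m n)
  have hd'' : ∀ k m n, W m k n k = G m n := fun k m n => (ht _ _ _ _).trans (hd' k m n)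
  have hd3 : ∀ k m n, W k m n k = G m n := fun k m n => (ht _ _ _ _).trans (hd k m n)
  -- When one of the first two indices of W equals one of the last two, W collapses to G at the
  -- remaining pair. Choosing m and n to force this turns relations on W into relations on G.
  have e03 : G 0 3 = 0 := by rw [← hd'' 0 0 3, h03, hG]
  have e30 : G 3 0 = 0 := by rw [← hd'' 0 3 0, h30, hG]
  have e1 : G 1 0 = G 1 3 := by rw [← h03 1 0, ht, hd]
  have e2 : G 2 0 = G 2 3 := by rw [← h03 2 0, ht, hd]
  have e3 : G 3 1 = G 0 1 := by rw [← h03 3 1, hd']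
  have e4 : G 3 2 = G 0 2 := by rw [← h03 3 2, hd']
  have e5 := h31 1 2
  rw [hd', hd', hd3, hG] at e5
  have e6 := h20 0 3
  rw [hd', hd3] at e6
  have e7 := h02 3 0
  rw [hd3, hd'] at e7
  have e8 := h13 2 1
  rw [hd3, hd', hd', hG] at e8
  funext k l
  fin_cases k <;> fin_cases l <;> simp <;> grind

section Quadratic
variable {W : Fin 4 → Fin 4 → Fin 4 → Fin 4 → ℂ}

/-- W vanishes when one of its first two indices equals one of its last two. Symmetry and `h02`
reduce most cases to this or to `h03`; only m = 1, n = 2 needs `h13`. -/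
lemma quadratic_zero_two_eq_zero
    (hs : ∀ k m l n, W k m l n = W m k l n) (ht : ∀ k m l n, W k m l n = W k m n l)
    (hd : ∀ k m n, W k m k n = 0) (h03 : ∀ m n, W 0 m 3 n = 0)
    (h13 : ∀ m n, W 1 m 3 n = W 1 m 2 n + W 3 m 2 n) (h02 : ∀ m n, W 0 m 2 n = W 1 m 3 n)
    (m n : Fin 4) : W 0 m 2 n = 0 := by
  have hd' : ∀ k m n, W m k k n = 0 := fun k m n => (hs _ _ _ _).trans (hd k m n)
  have hd'' : ∀ k m n, W k m n k = 0 := fun k m n => (ht _ _ _ _).trans (hd k m n)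
  have h0123 : W 0 1 2 3 = 0 := (ht _ _ _ _).trans (h03 1 2)
  match m with
  | 0 => rw [h02, hs, h03]
  | 1 =>
    match n with
    | 0 => exact hd'' _ _ _
    | 1 => rw [h02, hd'']
    | 2 =>
      have h := h13 1 3
      rw [← h02, h0123, hd'', add_zero] at h
      rw [h02, ht, ← h]
    | 3 => exact h0123
  | 2 => exact hd' _ _ _
  | 3 => rw [h02, hd']

/-- For fixed m and n, the entries (0,1), (2,1) and (2,3) are nonzero multiples of one another, so
it suffices that any one vanishes. -/
lemma quadratic_two_one_eq_zero
    (hs : ∀ k m l n, W k m l n = W m k l n) (ht : ∀ k m l n, W k m l n = W k m n l)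
    (hd : ∀ k m n, W k m k n = 0) (h03 : ∀ m n, W 0 m 3 n = 0)
    (h31 : ∀ m n, W 2 m 1 n + W 2 m 3 n = 0) (h21 : ∀ m n, 2 * W 0 m 1 n + 3 * W 2 m 1 n = 0)
    (m n : Fin 4) : W 2 m 1 n = 0 := by
  have hd' : ∀ k m n, W m k k n = 0 := fun k m n => (hs _ _ _ _).trans (hd k m n)
  have hd'' : ∀ k m n, W k m n k = 0 := fun k m n => (ht _ _ _ _).trans (hd k m n)
  have h01 : ∀ m n, W 0 m 1 n = 0 → W 2 m 1 n = 0 := fun m n h => by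
    simpa [h] using h21 m n
  have h23 : ∀ m n, W 2 m 3 n = 0 → W 2 m 1 n = 0 := fun m n h => by
    simpa [h] using h31 m n
  have h2213 : W 2 2 1 3 = 0 := h01 _ _ ((ht _ _ _ _).trans (h03 2 1))
  match m with
  | 0 => exact h23 _ _ ((hs _ _ _ _).trans (h03 _ _))
  | 1 => exact hd' _ _ _
  | 2 =>
    match n with
    | 0 => exact h01 _ _ (hd'' _ _ _)
    | 1 => exact h23 _ _ ((ht _ _ _ _).trans h2213)
    | 2 => exact hd'' _ _ _
    | 3 => exact h2213
  | 3 => exact h23 _ _ (hd' _ _ _)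

lemma quadratic_part_eq_zero
    (hs : ∀ k m l n, W k m l n = W m k l n) (ht : ∀ k m l n, W k m l n = W k m n l)
    (hd : ∀ k m n, W k m k n = 0) (h03 : ∀ m n, W 0 m 3 n = 0) (h30 : ∀ m n, W 3 m 0 n = 0)
    (h31 : ∀ m n, W 3 m 1 n = W 2 m 1 n + W 2 m 3 n)
    (h13 : ∀ m n, W 1 m 3 n = W 1 m 2 n + W 3 m 2 n)
    (h02 : ∀ m n, W 0 m 2 n = W 1 m 3 n) (h20 : ∀ m n, W 2 m 0 n = W 3 m 1 n)
    (h21 : ∀ m n, 2 * W 0 m 1 n + 2 * W 2 m 1 n = W 2 m 3 n + 2 * W 3 m 1 n)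
    (h12 : ∀ m n, 2 * W 1 m 0 n + 2 * W 1 m 2 n = W 3 m 2 n + 2 * W 1 m 3 n) : W = 0 := by
  have z02 := quadratic_zero_two_eq_zero hs ht hd h03 h13 h02
  -- The relations are invariant under exchanging the first and last index pairs of W, so each
  -- vanishing lemma serves twice.
  have z20 := quadratic_zero_two_eq_zero (W := fun k m l n => W l n k m)
    (fun k m l n => ht _ _ _ _) (fun k m l n => hs _ _ _ _) (fun k m n => hd k n m)
    (fun m n => h30 n m) (fun m n => h31 n m) (fun m n => h20 n m)
  have z13 := fun m n => (h02 m n).symm.trans (z02 m n)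
  have z31 := fun m n => (h20 m n).symm.trans (z20 n m)
  have z21 := quadratic_two_one_eq_zero hs ht hd h03 (fun m n => by rw [← h31, z31])
    (fun m n => by linear_combination h21 m n - h31 m n + 3 * z31 m n)
  have z12 := quadratic_two_one_eq_zero (W := fun k m l n => W l n k m)
    (fun k m l n => ht _ _ _ _) (fun k m l n => hs _ _ _ _) (fun k m n => hd k n m)
    (fun m n => h30 n m) (fun m n => by rw [← h13, z13])
    (fun m n => by linear_combination h12 n m - h13 n m + 3 * z13 n m)
  have z23 : ∀ m n, W 2 m 3 n = 0 := fun m n => by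
    linear_combination z31 m n - h31 m n - z21 m n
  have z32 : ∀ m n, W 3 m 2 n = 0 := fun m n => by
    linear_combination z13 m n - h13 m n - z12 n m
  have z01 : ∀ m n, W 0 m 1 n = 0 := fun m n => by
    linear_combination (h21 m n + z23 m n) / 2 + z31 m n - z21 m n
  have z10 : ∀ m n, W 1 m 0 n = 0 := fun m n => by
    linear_combination (h12 m n + z32 m n) / 2 + z13 m n - z12 n m
  funext k m l n
  match k, l with
  | 0, 0 => exact hd _ _ _
  | 0, 1 => exact z01 _ _
  | 0, 2 => exact z02 _ _
  | 0, 3 => exact h03 _ _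
  | 1, 0 => exact z10 _ _
  | 1, 1 => exact hd _ _ _
  | 1, 2 => exact z12 _ _
  | 1, 3 => exact z13 _ _
  | 2, 0 => exact z20 _ _
  | 2, 1 => exact z21 _ _
  | 2, 2 => exact hd _ _ _
  | 2, 3 => exact z23 _ _
  | 3, 0 => exact h30 _ _
  | 3, 1 => exact z31 _ _
  | 3, 2 => exact z32 _ _
  | 3, 3 => exact hd _ _ _

end Quadratic

/-- For fixed m and n, the array W k m l n - G m n in k and l satisfies the same marginal equations
as G. Combined with the symmetries of W, this first forces G = 0 and then W = 0. -/
theorem linearization_refMatrix_injective :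
    Function.Injective (linearization (gramBlock refMatrix)) := by
  rw [← LinearMap.ker_eq_bot, LinearMap.ker_eq_bot']
  rintro ⟨G, W⟩ h
  have h1 := congrFun (congrArg Prod.fst h)
  have h2 := fun a m n => congrFun (congrFun (congrFun (congrArg (fun x => x.2.1) h) a) m) n
  have hs : ∀ k m l n, W k m l n = W m k l n := fun k m l n => sub_eq_zero.1
    (congrFun (congrFun (congrFun (congrFun (congrArg (fun x => x.2.2.1) h) k) m) l) n)
  have ht : ∀ k m l n, W k m l n = W k m n l := fun k m l n => sub_eq_zero.1
    (congrFun (congrFun (congrFun (congrFun (congrArg (fun x => x.2.2.2) h) k) m) l) n)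
  have hG : ∀ k, G k k = 0 := eq_zero_of_sum_gramBlock_inl fun p q => h1 (Sum.inl (p, q))
  have hd : ∀ m n k, W k m k n - G m n = 0 := fun m n =>
    eq_zero_of_sum_gramBlock_inl (x := fun k l => W k m l n - G m n)
      fun p q => h2 (Sum.inl (p, q)) m n
  obtain ⟨-, -, -, -, g02, g20, g21, g12⟩ :=
    relations_of_sum_gramBlock_inr hG fun a => h1 (Sum.inr a)
  have hr := fun m n => relations_of_sum_gramBlock_inr (x := fun k l => W k m l n - G m n)
    (hd m n) fun a => h2 (Sum.inr a) m n
  have hG0 : G = 0 := by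
    refine linear_part_eq_zero hs ht hG (fun k m n => sub_eq_zero.1 (hd m n k))
      (fun m n => ?_) (fun m n => ?_) (fun m n => ?_) (fun m n => ?_) (fun m n => ?_)
      (fun m n => ?_) g02 g21 g12 <;>
    obtain ⟨r03, r30, r31, r13, r02, r20, -, -⟩ := hr m n
    · linear_combination r03
    · linear_combination r30
    · linear_combination r31
    · linear_combination r13
    · linear_combination r02
    · linear_combination r20
  subst hG0
  simp only [Pi.zero_apply, sub_zero] at hr hd
  have hW : W = 0 := quadratic_part_eq_zero hs ht (fun k m n => hd m n k)
    (fun m n => (hr m n).1) (fun m n => (hr m n).2.1) (fun m n => (hr m n).2.2.1)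
    (fun m n => (hr m n).2.2.2.1) (fun m n => (hr m n).2.2.2.2.1)
    (fun m n => (hr m n).2.2.2.2.2.1) (fun m n => (hr m n).2.2.2.2.2.2.1)
    (fun m n => (hr m n).2.2.2.2.2.2.2)
  rw [hW]
  rfl


/-! ### Two-body marginals in coordinates -/

/-- The entries of a two-body marginal of four qubits, as explicit sums over the basis labels of
the two remaining parties `i` and `j`. -/
lemma marginal_apply {S : Finset (Fin 4)} {i j : Fin 4} (hij : i ≠ j)
    (hS : ∀ k, k ∉ S ↔ k = i ∨ k = j) (ψ : PureState 4 2) (v w : Fin 4 → Fin 2) :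
    marginal S ψ (fun k => v k) (fun k => w k) = ∑ z : Fin 2 × Fin 2,
      ψ.1 (Function.update (Function.update v i z.1) j z.2) *
        star (ψ.1 (Function.update (Function.update w i z.1) j z.2)) := by
  let e : Config {k // k ∉ S} 2 ≃ Fin 2 × Fin 2 :=
    { toFun := fun c => (c ⟨i, (hS i).2 (Or.inl rfl)⟩, c ⟨j, (hS j).2 (Or.inr rfl)⟩)
      invFun := fun z k => if k.1 = i then z.1 else z.2
      left_inv := fun c => by
        funext ⟨k, hk⟩
        rcases (hS k).1 hk with rfl | rfl
        · simp
        · simp [hij.symm]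
      right_inv := fun z => by simp [hij.symm] }
  have hglue : ∀ (u : Fin 4 → Fin 2) (c : Config {k // k ∉ S} 2),
      glue S (fun k => u k) c = Function.update (Function.update u i (e c).1) j (e c).2 := by
    intro u c
    funext k
    by_cases hk : k ∈ S
    · have := (hS k).not.1 (not_not.2 hk)
      rw [not_or] at this
      simp [glue, hk, Function.update_of_ne this.1, Function.update_of_ne this.2]
    · rcases (hS k).1 hk with rfl | rfl
      · simp [glue, hk, Function.update_of_ne hij, e]
      · simp [glue, hk, e]
  simp only [marginal, reduce, density, Matrix.of_apply, hglue]
  exact e.sum_comp fun z => ψ.1 (Function.update (Function.update v i z.1) j z.2) *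
        star (ψ.1 (Function.update (Function.update w i z.1) j z.2))

lemma gram_eq_of_marginal_eq {φ ψ : PureState 4 2}
    (hAB : marginal {0, 1} φ = marginal {0, 1} ψ) (hBD : marginal {1, 3} φ = marginal {1, 3} ψ) :
    gram (coeffMatrix φ.1) (coeffMatrix φ.1) = gram (coeffMatrix ψ.1) (coeffMatrix ψ.1) := by
  funext a
  rcases a with ⟨⟨a, b⟩, ⟨a', b'⟩⟩ | ⟨⟨b, d⟩, ⟨b', d'⟩⟩
  · have h := congrFun (congrFun hAB fun k => ![a, b, 0, 0] k.1) fun k => ![a', b', 0, 0] k.1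
    rw [marginal_apply (i := 2) (j := 3) (by decide) (by decide),
      marginal_apply (i := 2) (j := 3) (by decide) (by decide)] at h
    have e : ∀ (x y : Fin 2) (z : Fin 2 × Fin 2),
        Function.update (Function.update ![x, y, 0, 0] 2 z.1) 3 z.2 = ![x, y, z.1, z.2] := by
      decide
    simp only [e] at h
    exact h
  · have h := congrFun (congrFun hBD fun k => ![0, b, 0, d] k.1) fun k => ![0, b', 0, d'] k.1
    rw [marginal_apply (i := 0) (j := 2) (by decide) (by decide),
      marginal_apply (i := 0) (j := 2) (by decide) (by decide)] at h
    have e : ∀ (x y : Fin 2) (z : Fin 2 × Fin 2),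
        Function.update (Function.update ![0, x, 0, y] 0 z.1) 2 z.2 = ![z.1, x, z.2, y] := by
      decide
    simp only [e] at h
    exact h

lemma conjTranspose_mul_eq_of_marginal_eq {φ ψ : PureState 4 2}
    (hCD : marginal {2, 3} φ = marginal {2, 3} ψ) :
    (coeffMatrix φ.1)ᴴ * coeffMatrix φ.1 = (coeffMatrix ψ.1)ᴴ * coeffMatrix ψ.1 := by
  ext ⟨c', d'⟩ ⟨c, d⟩
  -- Primed and unprimed labels are exchanged because Mᴴ M is the transpose of the marginal on CD.
  have h := congrFun (congrFun hCD fun k => ![0, 0, c, d] k.1) fun k => ![0, 0, c', d'] k.1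
  rw [marginal_apply (i := 0) (j := 1) (by decide) (by decide),
    marginal_apply (i := 0) (j := 1) (by decide) (by decide)] at h
  have e : ∀ (x y : Fin 2) (z : Fin 2 × Fin 2),
      Function.update (Function.update ![0, 0, x, y] 0 z.1) 1 z.2 = ![z.1, z.2, x, y] := by
    decide
  simp only [e] at h
  simp only [Matrix.mul_apply, Matrix.conjTranspose_apply, mul_comm (star _)]
  exact h

lemma coeffMatrix_injective : Function.Injective coeffMatrix := fun φ ψ h => by
  ext x
  have := congrFun (congrFun h (x 0, x 1)) (x 2, x 3)
  have e : ∀ x : Fin 4 → Fin 2, ![x 0, x 1, x 2, x 3] = x := by decide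
  simpa only [coeffMatrix, Matrix.of_apply, e] using this

/-! ### From almost every vector to almost every state -/

/-- `M` is determined up to a phase by its marginals on `AB`, `CD` and `BD`. -/
def IsDetermined (M : Matrix (Fin 2 × Fin 2) (Fin 2 × Fin 2) ℂ) : Prop :=
  ∀ N, gram N N = gram M M → Nᴴ * N = Mᴴ * M → ∃ z : ℂ, ‖z‖ = 1 ∧ N = z • M

lemma gram_smul (r : ℂ) (M : Matrix (Fin 2 × Fin 2) (Fin 2 × Fin 2) ℂ) :
    gram (r • M) (r • M) = (r * star r) • gram M M := by
  funext a
  have := gram_sum (fun _ : Unit => r) (fun _ => M) a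
  simpa using this

lemma IsDetermined.of_smul {M : Matrix (Fin 2 × Fin 2) (Fin 2 × Fin 2) ℂ} {r : ℂ} (hr : r ≠ 0)
    (h : IsDetermined (r • M)) : IsDetermined M := by
  intro N h1 h2
  obtain ⟨z, hz, hN⟩ := h (r • N) (by rw [gram_smul, gram_smul, h1])
    (by simp only [Matrix.conjTranspose_smul, Matrix.smul_mul, Matrix.mul_smul, h2])
  refine ⟨z, hz, smul_right_injective _ hr ?_⟩
  simpa only [smul_comm r z] using hN

theorem ae_isDetermined : ∀ᵐ ψ : StateSpace 4 2, IsDetermined (coeffMatrix ψ) := by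
  have h := ae_nondegenerate (ψ₀ := refState)
    (by rw [coeffMatrix_refState]; exact refMatrix_mulVecLin_injective)
    (by rw [coeffMatrix_refState]; exact cyclicMap_refMatrix_injective)
    (by rw [coeffMatrix_refState]; exact linearization_refMatrix_injective)
  exact h.mono fun ψ hψ N h1 h2 => eq_smul_of_gram_eq hψ.1 hψ.2.1 hψ.2.2 h1 h2

theorem ae_haarPure_isDetermined :
    ∀ᵐ ψ ∂(haarPure 4 2), IsDetermined (coeffMatrix ψ.1) := by
  refine Measure.ae_smul_measure (ae_toSphere_of_ae volume
    (p := fun ψ : StateSpace 4 2 => IsDetermined (coeffMatrix ψ)) (fun ψ r hr h => ?_)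
    ae_isDetermined) _
  refine IsDetermined.of_smul (r := (r : ℂ)) (by exact_mod_cast hr.ne') ?_
  convert h using 1
  ext p q
  simp [coeffMatrix]

lemma IsDetermined.determinedAmongPureBy {ψ : PureState 4 2} (h : IsDetermined (coeffMatrix ψ.1))
    {F : Set (Finset (Fin 4))} (hAB : {0, 1} ∈ F) (hCD : {2, 3} ∈ F) (hBD : {1, 3} ∈ F) :
    DeterminedAmongPureBy F ψ := by
  intro φ hφ
  obtain ⟨z, hz, hN⟩ := h _ (gram_eq_of_marginal_eq (hφ _ hAB) (hφ _ hBD))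
    (conjTranspose_mul_eq_of_marginal_eq (hφ _ hCD))
  obtain ⟨θ, rfl⟩ := (Complex.norm_eq_one_iff z).1 hz
  exact ⟨θ, coeffMatrix_injective hN⟩

end QuantumMarginals
end

/-- Parties `A`, `B`, `C`, `D` are numbered `0`, `1`, `2`, `3`. -/
theorem theorem1 :
    ∀ᵐ ψ ∂(QuantumMarginals.haarPure 4 2),
      QuantumMarginals.DeterminedAmongPureBy {{0, 1}, {2, 3}, {1, 3}} ψ ∧
        QuantumMarginals.IsUDP 2 ψ :=
  QuantumMarginals.ae_haarPure_isDetermined.mono fun _ h =>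
    ⟨h.determinedAmongPureBy (by simp) (by simp) (by simp),
      h.determinedAmongPureBy (F := {S | S.card = 2}) rfl rfl rfl⟩
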